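/- \textbf{Theorem.} Let $\mu$ be a probability measure on a measurable space $\mathcal X$. Write $\|\cdot\|$ for the norm of $\mathbb L_2(\mu)$, $d_2(s,t)=\|s-t\|$, and let $\overline{\mathbb L}_2$ be the set of $s\in\mathbb L_2(\mu)$ with $s\ge 0$ $\mu$-a.e. and $\int s\,d\mu=1$. Let $\lambda\in(0,1)$ and $n$ be an integer, $n\ge 0$. For $s\in\overline{\mathbb L}_2$, let $\mathbb P_s$ be the probability under which $X_1,\dots,X_n$ (with distribution $s\cdot\mu$), $Z_1,\dots,Z_n$ (with distribution $\mu$) and $\varepsilon_1,\dots,\varepsilon_n$ (Bernoulli with parameter $\lambda$) are all independent, and let $\boldsymbol X'=(X_1',\dots,X_n')$ be the randomized sample $X_i'=\varepsilon_iX_i+(1-\varepsilon_i)Z_i$, that is, $X_i'=X_i$ if $\varepsilon_i=1$ and $X_i'=Z_i$ if $\varepsilon_i=0$. There is a universal value of $\lambda\in(0,1)$ for which the following holds, whatever $\mathcal X$, $\mu$ and $n$. Let $\Gamma<+\infty$ and let $t\neq u$ be two elements of $\overline{\mathbb L}_2$ with $\|t\|_\infty\le\Gamma$ and $\|u\|_\infty\le\Gamma$.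 For every $x\in\mathbb R$ there is a test $\psi_{t,u,x}$ between $t$ and $u$ (a measurable function on $\mathcal X^n$ with values in $\{t,u\}$) such that $$\sup_{\{s\in\overline{\mathbb L}_2\,:\,d_2(s,t)\le d_2(t,u)/4\}}\mathbb P_s\left[\psi_{t,u,x}(\boldsymbol X')=u\right]\le\exp\left[-\frac{n\left(\|t-u\|^2+x\right)}{65\,\Gamma}\right],$$ $$\sup_{\{s\in\overline{\mathbb L}_2\,:\,d_2(s,u)\le d_2(t,u)/4\}}\mathbb P_s\left[\psi_{t,u,x}(\boldsymbol X')=t\right]\le\exp\left[-\frac{n\left(\|t-u\|^2-x\right)}{65\,\Gamma}\right].$$ -/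

import Mathlib

open MeasureTheory
open scoped ENNReal

noncomputable section

/-- `s` is a probability density with respect to `μ` belonging to `L²(μ)`. -/
def IsL2Density {X : Type*} [MeasurableSpace X] {μ : Measure X} (s : Lp ℝ 2 μ) : Prop :=
  (∀ᵐ x ∂μ, 0 ≤ s x) ∧ ∫ x, s x ∂μ = 1

/-- `s` is a probability density with respect to `μ` with `‖s‖_∞ ≤ Γ`. -/
def IsBoundedDensity {X : Type*} [MeasurableSpace X] {μ : Measure X} (Γ : ℝ)
    (s : Lp ℝ 2 μ) : Prop :=
  IsL2Density s ∧ eLpNorm s ∞ μ ≤ ENNReal.ofReal Γ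

/-- The distribution `P_s = s · μ` of one observation with density `s`. -/
def densityLaw {X : Type*} [MeasurableSpace X] {μ : Measure X} (s : Lp ℝ 2 μ) : Measure X :=
  μ.withDensity fun x => ENNReal.ofReal (s x)

/-- The joint law `ℙ_s` of three independent i.i.d. `n`-samples: the observations `X₁, …, Xₙ` with
density `s`, auxiliary variables `Z₁, …, Zₙ` with law `μ`, and Bernoulli variables
`ε₁, …, εₙ` with parameter `lam` (`true` has probability `lam` and `false` has `1 - lam`). -/
def randomizedLaw {X : Type*} [MeasurableSpace X] {μ : Measure X} (lam : unitInterval) (n : ℕ)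
    (s : Lp ℝ 2 μ) : Measure ((Fin n → X) × (Fin n → X) × (Fin n → Bool)) :=
  (Measure.pi fun _ : Fin n => densityLaw s).prod
    ((Measure.pi fun _ : Fin n => μ).prod
      (Measure.pi fun _ : Fin n => ProbabilityTheory.bernoulliMeasure true false lam))

/-- The randomized sample `X'_i = ε_i X_i + (1 - ε_i) Z_i`: it equals `X_i` when `ε_i = 1` and `Z_i`
when `ε_i = 0`. -/
def randomizedSample {X : Type*} {n : ℕ} (ω : (Fin n → X) × (Fin n → X) × (Fin n → Bool)) :
    Fin n → X :=
  fun i => if ω.2.2 i = true then ω.1 i else ω.2.1 i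

/-- A test between `t` and `u`: a measurable function of the sample with values in `{t, u}`. -/
structure IsTest {X : Type*} [MeasurableSpace X] {μ : Measure X} {n : ℕ} (t u : Lp ℝ 2 μ)
    (ψ : (Fin n → X) → Lp ℝ 2 μ) : Prop where
  mem : ∀ y, ψ y = t ∨ ψ y = u
  measurable_left : MeasurableSet {y | ψ y = t}
  measurable_right : MeasurableSet {y | ψ y = u}

end

/-! Take `lam = 9/10`, so that the randomized observations are i.i.d. with density `9/10 s + 1/10`,
and choose `u` when a sum of affine scores in `f = u - t` reaches `n x / (65 Γ)`. The centring
`9/100 = 9/10 * 1/5 * 1/2` makes the score have mean zero at the midpoint `s = (t + u)/2`, and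
exchanging `t` and `u` negates it, so one error bound gives both. By Chernoff's bound
(`randomizedLaw_sum_ge_le`) it suffices that one score has exponential moment at most
`exp(-d²/(65Γ))`, `d = ‖t - u‖`, when `s` is within `d/4` of `t`. This is `integral_mixture_exp_le`.
Since `|f| ≤ Γ`, a second-order expansion of `exp` applies to `f/(5Γ)`. The linear term gains a
multiple of `d²/Γ` from the geometry of L². In the quadratic term `s` may be unbounded, but `s = t +
w` with `t ≤ Γ` and `w` small in L², so `∫ s f²` is still of order `Γ d²`. -/

/-! ### Product structure of the randomized sample and Chernoff's bound. -/

lemma lintegral_bernoulliMeasure_bool (p : unitInterval) (g : Bool → ℝ≥0∞) :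
    ∫⁻ b, g b ∂(ProbabilityTheory.bernoulliMeasure true false p) =
      ENNReal.ofReal p * g true + ENNReal.ofReal (1 - p) * g false := by
  have key : ∀ q : unitInterval, ((unitInterval.toNNReal q : NNReal) : ℝ≥0∞) =
      ENNReal.ofReal q := by
    intro q
    rw [ENNReal.ofReal, ENNReal.coe_inj]
    ext
    simp [q.2.1]
  rw [ProbabilityTheory.bernoulliMeasure_def, lintegral_add_measure]
  erw [lintegral_smul_measure, lintegral_smul_measure]
  rw [lintegral_dirac, lintegral_dirac]
  have h1 := key p
  have h2 := key (unitInterval.symm p)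
  rw [unitInterval.coe_symm_eq] at h2
  rw [← h1, ← h2]
  rfl

lemma lintegral_pi_prod_eq {X : Type*} [MeasurableSpace X] (ν : Measure X) [SigmaFinite ν]
    {n : ℕ} (g : Fin n → X → ℝ≥0∞) (hg : ∀ i, Measurable (g i)) :
    ∫⁻ x : Fin n → X, ∏ i, g i (x i) ∂(Measure.pi fun _ => ν) = ∏ i, ∫⁻ x, g i x ∂ν := by
  induction n with
  | zero => simp
  | succ n ih =>
    have hmp := (measurePreserving_piFinSuccAbove (fun _ : Fin (n + 1) => ν) 0).symm
    rw [← hmp.lintegral_comp (by fun_prop)]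
    simp_rw [MeasurableEquiv.piFinSuccAbove_symm_apply, Fin.insertNthEquiv,
      Fin.prod_univ_succ, Fin.insertNth_zero, Equiv.coe_fn_mk, Fin.cons_succ, Fin.cons_zero]
    rw [← ih (fun i => g i.succ) (fun i => hg _)]
    exact lintegral_prod_mul (μ := ν) (ν := Measure.pi fun _ => ν) (hg 0).aemeasurable
      (g := fun y : Fin n → X => ∏ i, g i.succ (y i))
      (Finset.measurable_prod _ fun i _ =>
        (hg i.succ).comp (measurable_pi_apply i)).aemeasurable

section Density

variable {X : Type*} [MeasurableSpace X] {μ : Measure X}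

lemma isProbabilityMeasure_densityLaw [IsProbabilityMeasure μ] {s : Lp ℝ 2 μ}
    (hs : IsL2Density s) : IsProbabilityMeasure (densityLaw s) := by
  constructor
  rw [densityLaw, withDensity_apply _ MeasurableSet.univ, Measure.restrict_univ,
    ← ofReal_integral_eq_lintegral_ofReal ((Lp.memLp s).integrable (by norm_num)) hs.1, hs.2,
    ENNReal.ofReal_one]

lemma measurable_coeFn_Lp (s : Lp ℝ 2 μ) : Measurable s := (Lp.stronglyMeasurable s).measurable

lemma measurable_randomizedSample {n : ℕ} :
    Measurable (randomizedSample : ((Fin n → X) × (Fin n → X) × (Fin n → Bool)) → _) := by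
  refine measurable_pi_lambda _ fun i => Measurable.ite ?_ (by fun_prop) (by fun_prop)
  exact (by fun_prop : Measurable fun ω : (Fin n → X) × (Fin n → X) × (Fin n → Bool) =>
    ω.2.2 i) (measurableSet_singleton true)

/-- The multiplicative functionals of the randomized sample factorize: its coordinates are i.i.d.
with law `lam • P_s + (1 - lam) • μ`. -/
lemma lintegral_randomizedLaw_prod [IsProbabilityMeasure μ] (lam : unitInterval) (n : ℕ)
    {s : Lp ℝ 2 μ} (hs : IsL2Density s) {g : X → ℝ≥0∞} (hg : Measurable g) :
    ∫⁻ ω, ∏ i, g (randomizedSample ω i) ∂(randomizedLaw lam n s) =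
      (ENNReal.ofReal lam * ∫⁻ x, g x ∂(densityLaw s) +
        ENNReal.ofReal (1 - lam) * ∫⁻ x, g x ∂μ) ^ n := by
  have := isProbabilityMeasure_densityLaw hs
  have hm : Measurable fun ω : (Fin n → X) × (Fin n → X) × (Fin n → Bool) =>
      ∏ i, g (randomizedSample ω i) :=
    Finset.measurable_prod _ fun i _ =>
      hg.comp ((measurable_pi_apply i).comp measurable_randomizedSample)
  rw [randomizedLaw, lintegral_prod _ hm.aemeasurable]
  -- Integrate out `ε`, then `Z`, then `X`: at each stage the integrand is still a product over
  -- coordinates.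
  have inner : ∀ x z : Fin n → X,
      ∫⁻ e, ∏ i, g (randomizedSample (x, z, e) i)
        ∂(Measure.pi fun _ : Fin n => ProbabilityTheory.bernoulliMeasure true false lam) =
      ∏ i, (ENNReal.ofReal lam * g (x i) + ENNReal.ofReal (1 - lam) * g (z i)) := by
    intro x z
    have h := lintegral_pi_prod_eq (ProbabilityTheory.bernoulliMeasure true false lam)
      (fun (i : Fin n) (b : Bool) => g (if b = true then x i else z i))
      (fun i => measurable_of_finite _)
    simp only [lintegral_bernoulliMeasure_bool] at h
    simpa [randomizedSample] using h
  have mid : ∀ x : Fin n → X,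
      ∫⁻ p, ∏ i, g (randomizedSample (x, p) i) ∂((Measure.pi fun _ : Fin n => μ).prod
        (Measure.pi fun _ : Fin n => ProbabilityTheory.bernoulliMeasure true false lam)) =
      ∏ i, (ENNReal.ofReal lam * g (x i) + ENNReal.ofReal (1 - lam) * ∫⁻ z, g z ∂μ) := by
    intro x
    have hmx : Measurable fun p : (Fin n → X) × (Fin n → Bool) =>
        ∏ i, g (randomizedSample (x, p) i) := hm.comp measurable_prodMk_left
    rw [lintegral_prod _ hmx.aemeasurable]
    simp_rw [inner]
    rw [lintegral_pi_prod_eq μ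
      (fun (i : Fin n) z => ENNReal.ofReal lam * g (x i) + ENNReal.ofReal (1 - lam) * g z)
      (fun i => by fun_prop)]
    refine Finset.prod_congr rfl fun i _ => ?_
    rw [lintegral_add_left measurable_const, lintegral_const_mul _ hg]
    simp
  simp_rw [mid]
  rw [lintegral_pi_prod_eq (densityLaw s)
      (fun (_ : Fin n) x => ENNReal.ofReal lam * g x + ENNReal.ofReal (1 - lam) * ∫⁻ z, g z ∂μ)
      (fun i => by fun_prop)]
  rw [Finset.prod_const, Finset.card_univ, Fintype.card_fin,
    lintegral_add_right _ measurable_const, lintegral_const_mul _ hg]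
  simp

/-- Chernoff's bound for a sum over the randomized sample. -/
lemma randomizedLaw_sum_ge_le [IsProbabilityMeasure μ] (lam : unitInterval) (n : ℕ)
    {s : Lp ℝ 2 μ} (hs : IsL2Density s) {φ : X → ℝ} (hφ : Measurable φ) (c : ℝ) :
    randomizedLaw lam n s {ω | c ≤ ∑ i, φ (randomizedSample ω i)} ≤
      ENNReal.ofReal (Real.exp (-c)) *
        (ENNReal.ofReal lam * ∫⁻ x, ENNReal.ofReal (Real.exp (φ x)) ∂(densityLaw s) +
          ENNReal.ofReal (1 - lam) * ∫⁻ x, ENNReal.ofReal (Real.exp (φ x)) ∂μ) ^ n := by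
  have hg : Measurable fun x => ENNReal.ofReal (Real.exp (φ x)) := by fun_prop
  rw [← lintegral_randomizedLaw_prod lam n hs hg]
  have hm : Measurable fun ω : (Fin n → X) × (Fin n → X) × (Fin n → Bool) =>
      ∏ i, ENNReal.ofReal (Real.exp (φ (randomizedSample ω i))) :=
    Finset.measurable_prod _ fun i _ =>
      hg.comp ((measurable_pi_apply i).comp measurable_randomizedSample)
  have hsub : {ω : (Fin n → X) × (Fin n → X) × (Fin n → Bool) |
        c ≤ ∑ i, φ (randomizedSample ω i)} ⊆
      {ω | ENNReal.ofReal (Real.exp c) ≤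
        ∏ i, ENNReal.ofReal (Real.exp (φ (randomizedSample ω i)))} := by
    intro ω hω
    simp only [Set.mem_ofPred_eq] at hω ⊢
    rw [← ENNReal.ofReal_prod_of_nonneg (fun i _ => (Real.exp_pos _).le), ← Real.exp_sum]
    exact ENNReal.ofReal_le_ofReal (Real.exp_le_exp.2 hω)
  calc randomizedLaw lam n s {ω | c ≤ ∑ i, φ (randomizedSample ω i)}
      = ENNReal.ofReal (Real.exp (-c)) * (ENNReal.ofReal (Real.exp c) *
          randomizedLaw lam n s {ω | c ≤ ∑ i, φ (randomizedSample ω i)}) := by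
        rw [← mul_assoc, ← ENNReal.ofReal_mul (Real.exp_pos _).le, ← Real.exp_add]
        simp
    _ ≤ _ := by
        gcongr
        exact (mul_le_mul_right (measure_mono hsub) _).trans (mul_meas_ge_le_lintegral hm _)

/-! ### Exponential moment of the score. -/

/-- The Taylor remainder is at most `2/9 |y|³ ≤ 2/45 y²`, and `1/2 + 2/45 < 109/200`. -/
lemma exp_le_one_add_add_sq {y : ℝ} (hy : |y| ≤ 1 / 5) :
    Real.exp y ≤ 1 + y + 109 / 200 * y ^ 2 := by
  have h := (abs_le.1 (Real.exp_bound (hy.trans (by norm_num)) (n := 3) (by norm_num))).2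
  have h3 : |y| ^ 3 ≤ 1 / 5 * y ^ 2 := by
    rw [pow_succ, sq_abs, mul_comm]
    gcongr
  norm_num [Finset.sum_range_succ, Nat.factorial] at h
  nlinarith [sq_nonneg y]

/-- The affine score comparing `u` to `t`, centred at the midpoint of `t` and `u`. -/
noncomputable def score (Γ : ℝ) (t u : Lp ℝ 2 μ) (x : X) : ℝ :=
  ((u x - t x) / 5 - 9 / 100 * (‖u‖ ^ 2 - ‖t‖ ^ 2)) / Γ

lemma measurable_score (Γ : ℝ) (t u : Lp ℝ 2 μ) : Measurable (score Γ t u) := by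
  have := measurable_coeFn_Lp t
  have := measurable_coeFn_Lp u
  unfold score
  fun_prop

lemma score_swap (Γ : ℝ) (t u : Lp ℝ 2 μ) (x : X) : score Γ u t x = -score Γ t u x := by
  unfold score
  ring

/-- A density of mass 1 under a probability measure cannot stay below a constant less than 1. The
detour through `max Γ 0` is needed because `ENNReal.ofReal` truncates negative `Γ`. -/
lemma IsBoundedDensity.ae_le {Γ : ℝ} {t : Lp ℝ 2 μ} [IsProbabilityMeasure μ]
    (ht : IsBoundedDensity Γ t) : 1 ≤ Γ ∧ ∀ᵐ x ∂μ, t x ≤ Γ := by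
  have h0 : ∀ᵐ x ∂μ, t x ≤ max Γ 0 := by
    filter_upwards [ae_le_eLpNormEssSup (f := t) (μ := μ)] with x hx
    have h := hx.trans (eLpNorm_exponent_top (f := t) (μ := μ) ▸ ht.2)
    rw [← ofReal_norm, ENNReal.ofReal_le_ofReal_iff'] at h
    have := Real.le_norm_self (t x)
    have := norm_nonneg (t x)
    rcases h with h | h
    · exact (by linarith : t x ≤ Γ).trans (le_max_left _ _)
    · exact (by linarith : t x ≤ 0).trans (le_max_right _ _)
  have h1 : (1 : ℝ) ≤ max Γ 0 := by
    calc (1 : ℝ) = ∫ x, t x ∂μ := ht.1.2.symm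
      _ ≤ ∫ _, max Γ 0 ∂μ :=
        integral_mono_ae ((Lp.memLp t).integrable (by norm_num)) (integrable_const _) h0
      _ = max Γ 0 := by simp
  have h2 : 1 ≤ Γ := by
    rcases le_max_iff.1 h1 with h | h
    · exact h
    · norm_num at h
  exact ⟨h2, by rwa [max_eq_left (by linarith)] at h0⟩

lemma integrable_coeFn_mul (f g : Lp ℝ 2 μ) : Integrable (fun x => f x * g x) μ :=
  (Lp.memLp f).integrable_mul (Lp.memLp g)

lemma inner_eq_integral_mul (f g : Lp ℝ 2 μ) : inner ℝ f g = ∫ x, f x * g x ∂μ := by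
  rw [L2.inner_def]
  refine integral_congr_ae (.of_forall fun x => ?_)
  simp [mul_comm]

/-- The exponential moment of a linear score under the randomized density. -/
lemma integral_mixture_exp_le [IsProbabilityMeasure μ] {Γ : ℝ} {t u s : Lp ℝ 2 μ}
    (ht : IsBoundedDensity Γ t) (hu : IsBoundedDensity Γ u) (hs : IsL2Density s)
    (hst : dist s t ≤ dist t u / 4) :
    Integrable (fun x => (9 / 10 * s x + 1 / 10) * Real.exp ((u x - t x) / (5 * Γ))) μ ∧
    ∫ x, (9 / 10 * s x + 1 / 10) * Real.exp ((u x - t x) / (5 * Γ)) ∂μ ≤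
      Real.exp (9 / 100 * (‖u‖ ^ 2 - ‖t‖ ^ 2) / Γ - ‖t - u‖ ^ 2 / (65 * Γ)) := by
  obtain ⟨hΓ, htΓ⟩ := ht.ae_le
  obtain ⟨-, huΓ⟩ := hu.ae_le
  have hΓ0 : 0 < Γ := by linarith
  have hsI : Integrable s μ := (Lp.memLp s).integrable (by norm_num)
  have htI : Integrable t μ := (Lp.memLp t).integrable (by norm_num)
  have huI : Integrable u μ := (Lp.memLp u).integrable (by norm_num)
  set f : Lp ℝ 2 μ := u - t with hf
  set w : Lp ℝ 2 μ := s - t with hw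
  have hfI : Integrable f μ := (Lp.memLp f).integrable (by norm_num)
  have hfx : ∀ᵐ x ∂μ, f x = u x - t x := Lp.coeFn_sub u t
  have hwx : ∀ᵐ x ∂μ, w x = s x - t x := Lp.coeFn_sub s t
  have habs : ∀ᵐ x ∂μ, |f x| ≤ Γ := by
    filter_upwards [hfx, htΓ, huΓ, ht.1.1, hu.1.1] with x h1 h2 h3 h4 h5
    rw [h1, abs_le]
    constructor <;> linarith
  set d : ℝ := ‖t - u‖ with hd
  have hfd : ‖f‖ = d := norm_sub_rev u t
  have hwd : ‖w‖ ≤ d / 4 := by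
    rw [hw, hd, ← dist_eq_norm, ← dist_eq_norm]
    exact hst
  have hd0 : 0 ≤ d := norm_nonneg _
  -- Polarization gives `⟨t, f⟩ = (‖u‖² - ‖t‖² - d²)/2`, and Cauchy–Schwarz gives `⟨w, f⟩ ≤ d²/4`.
  have hsf : ∫ x, s x * f x ∂μ ≤ (‖u‖ ^ 2 - ‖t‖ ^ 2) / 2 - d ^ 2 / 4 := by
    rw [← inner_eq_integral_mul]
    have e1 : inner ℝ s f = inner ℝ w f + inner ℝ t f := by
      rw [← inner_add_left, hw, sub_add_cancel]
    have e2 : ‖u‖ ^ 2 = ‖t‖ ^ 2 + 2 * inner ℝ t f + ‖f‖ ^ 2 := by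
      rw [← norm_add_sq_real, hf, add_sub_cancel]
    have e3 := real_inner_le_norm w f
    rw [hfd] at e2 e3
    have e4 : ‖w‖ * d ≤ d / 4 * d := by gcongr
    rw [e1]
    linarith
  have hff : ∫ x, f x * f x ∂μ = d ^ 2 := by
    rw [← inner_eq_integral_mul, real_inner_self_eq_norm_sq, hfd]
  have hww : ∫ x, w x * w x ∂μ ≤ d ^ 2 / 16 := by
    rw [← inner_eq_integral_mul, real_inner_self_eq_norm_sq]
    nlinarith [norm_nonneg w]
  have hf0 : ∫ x, f x ∂μ = 0 := by
    rw [integral_congr_ae hfx, integral_sub huI htI, hu.1.2, ht.1.2, sub_self]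
  have hIsf := integrable_coeFn_mul s f
  have hIff := integrable_coeFn_mul f f
  have hIww := integrable_coeFn_mul w w
  -- An integrable majorant in which `s f²`, not known to be integrable with a usable bound, is
  -- replaced by `f²` and `w²`. Here `81/80 = 9/10 * 9/8` and `9/5 = 9/10 * 2`.
  set B : X → ℝ := fun x => 9 / 10 * s x + 1 / 10 + (9 / (50 * Γ)) * (s x * f x) +
    (1 / (50 * Γ)) * f x + 109 / (5000 * Γ) * ((1 / 10 + 81 / 80) * (f x * f x) +
      9 / 5 * (w x * w x)) with hB
  have hpt : ∀ᵐ x ∂μ, (9 / 10 * s x + 1 / 10) * Real.exp ((u x - t x) / (5 * Γ)) ≤ B x := by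
    filter_upwards [hfx, hwx, habs, hs.1, htΓ, ht.1.1] with x h1 h2 h3 h4 h5 h6
    rw [← h1]
    have hy : |f x / (5 * Γ)| ≤ 1 / 5 := by
      rw [abs_div, abs_of_pos (by linarith : (0 : ℝ) < 5 * Γ), div_le_div_iff₀ (by linarith)
        (by norm_num)]
      linarith
    have he := exp_le_one_add_add_sq hy
    have hfw : s x * (f x * f x) ≤ Γ * (9 / 8 * (f x * f x) + 2 * (w x * w x)) := by
      have a1 : s x = t x + w x := by linarith
      have a2 : w x * (f x * f x) ≤ Γ * (|f x| * |w x|) := by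
        calc w x * (f x * f x) ≤ |w x| * (|f x| * |f x|) := by
              rw [abs_mul_abs_self]
              exact mul_le_mul_of_nonneg_right (le_abs_self _) (mul_self_nonneg _)
          _ = |f x| * (|f x| * |w x|) := by ring
          _ ≤ _ := by gcongr
      -- The weights give equality at `|f| = 4|w|`, matching `‖w‖ ≤ ‖f‖/4`.
      have a3 : |f x| * |w x| ≤ 1 / 8 * (f x * f x) + 2 * (w x * w x) := by
        nlinarith [sq_nonneg (|f x| - 4 * |w x|), abs_mul_abs_self (f x), abs_mul_abs_self (w x)]
      have a4 := mul_le_mul_of_nonneg_left a3 hΓ0.le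
      have a5 := mul_le_mul_of_nonneg_right h5 (mul_self_nonneg (f x))
      rw [a1]
      linarith
    have hq : (9 / 10 * s x + 1 / 10) * (f x * f x) ≤
        Γ * ((1 / 10 + 81 / 80) * (f x * f x) + 9 / 5 * (w x * w x)) := by
      have b1 : f x * f x ≤ Γ * (f x * f x) := le_mul_of_one_le_left (mul_self_nonneg _) hΓ
      linarith
    calc (9 / 10 * s x + 1 / 10) * Real.exp (f x / (5 * Γ))
        ≤ (9 / 10 * s x + 1 / 10) *
            (1 + f x / (5 * Γ) + 109 / 200 * (f x / (5 * Γ)) ^ 2) := by gcongr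
      _ = 9 / 10 * s x + 1 / 10 + (9 / (50 * Γ)) * (s x * f x) + (1 / (50 * Γ)) * f x +
            109 / (5000 * Γ ^ 2) * ((9 / 10 * s x + 1 / 10) * (f x * f x)) := by
          field_simp
          ring
      _ ≤ 9 / 10 * s x + 1 / 10 + (9 / (50 * Γ)) * (s x * f x) + (1 / (50 * Γ)) * f x +
            109 / (5000 * Γ ^ 2) *
              (Γ * ((1 / 10 + 81 / 80) * (f x * f x) + 9 / 5 * (w x * w x))) := by gcongr
      _ = B x := by
          rw [hB]
          field_simp
  have hI1 : Integrable (fun x => 9 / 10 * s x + 1 / 10) μ :=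
    (hsI.const_mul _).add (integrable_const _)
  have hI2 := hI1.add (hIsf.const_mul (9 / (50 * Γ)))
  have hI3 := hI2.add (hfI.const_mul (1 / (50 * Γ)))
  have hI4 := (hIff.const_mul (1 / 10 + 81 / 80)).add (hIww.const_mul (9 / 5))
  have hBI : Integrable B μ := hI3.add (hI4.const_mul (109 / (5000 * Γ)))
  have hBint : ∫ x, B x ∂μ = 1 + (9 / (50 * Γ)) * ∫ x, s x * f x ∂μ +
      109 / (5000 * Γ) * ((1 / 10 + 81 / 80) * d ^ 2 + 9 / 5 * ∫ x, w x * w x ∂μ) := by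
    have e4 := integral_add hI3 (hI4.const_mul (109 / (5000 * Γ)))
    have e3 := integral_add hI2 (hfI.const_mul (1 / (50 * Γ)))
    have e2 := integral_add hI1 (hIsf.const_mul (9 / (50 * Γ)))
    have e1 := integral_add (hsI.const_mul (9 / 10)) (integrable_const (μ := μ) (1 / 10 : ℝ))
    have e5 := integral_add (hIff.const_mul (1 / 10 + 81 / 80)) (hIww.const_mul (9 / 5))
    simp only [Pi.add_apply, integral_const_mul, hff, hf0, hs.2, integral_const, probReal_univ,
      smul_eq_mul] at e1 e2 e3 e4 e5
    rw [hB]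
    rw [e4, e3, e2, e1, e5]
    ring
  have hEI : Integrable
      (fun x => (9 / 10 * s x + 1 / 10) * Real.exp ((u x - t x) / (5 * Γ))) μ := by
    have m1 := measurable_coeFn_Lp s
    have m2 := measurable_coeFn_Lp t
    have m3 := measurable_coeFn_Lp u
    refine hBI.mono' (by fun_prop) ?_
    filter_upwards [hpt, hs.1] with x hx hx0
    rwa [Real.norm_of_nonneg (by positivity)]
  refine ⟨hEI, (integral_mono_ae hEI hBI hpt).trans ?_⟩
  rw [hBint]
  refine le_trans ?_ (Real.add_one_le_exp _)
  have k1 : (9 / (50 * Γ)) * ∫ x, s x * f x ∂μ ≤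
      (9 / (50 * Γ)) * ((‖u‖ ^ 2 - ‖t‖ ^ 2) / 2 - d ^ 2 / 4) := by gcongr
  have k2 : 109 / (5000 * Γ) * ((1 / 10 + 81 / 80) * d ^ 2 + 9 / 5 * ∫ x, w x * w x ∂μ) ≤
      109 / (5000 * Γ) * ((1 / 10 + 81 / 80) * d ^ 2 + 9 / 5 * (d ^ 2 / 16)) := by gcongr
  -- The numerical margin: `9/200 - 109/5000 * 49/40 ≈ 0.0183` exceeds `1/65 ≈ 0.0154`.
  have k3 : 9 / 100 * (‖u‖ ^ 2 - ‖t‖ ^ 2) / Γ - d ^ 2 / (65 * Γ) -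
      ((9 / (50 * Γ)) * ((‖u‖ ^ 2 - ‖t‖ ^ 2) / 2 - d ^ 2 / 4) +
        109 / (5000 * Γ) * ((1 / 10 + 81 / 80) * d ^ 2 + 9 / 5 * (d ^ 2 / 16))) =
      (9 / 200 - 1 / 65 - 109 / 5000 * (49 / 40)) * (d ^ 2 / Γ) := by
    field_simp
    ring
  have k4 : 0 ≤ d ^ 2 / Γ := by positivity
  nlinarith

/-- The exponential moment of the score under the law of one randomized observation. -/
lemma lintegral_mixture_exp_score_le [IsProbabilityMeasure μ] {Γ : ℝ} {t u s : Lp ℝ 2 μ}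
    (ht : IsBoundedDensity Γ t) (hu : IsBoundedDensity Γ u) (hs : IsL2Density s)
    (hst : dist s t ≤ dist t u / 4) {lam : unitInterval} (hlam : (lam : ℝ) = 9 / 10) :
    ENNReal.ofReal lam * ∫⁻ x, ENNReal.ofReal (Real.exp (score Γ t u x)) ∂(densityLaw s) +
        ENNReal.ofReal (1 - lam) * ∫⁻ x, ENNReal.ofReal (Real.exp (score Γ t u x)) ∂μ ≤
      ENNReal.ofReal (Real.exp (-(‖t - u‖ ^ 2 / (65 * Γ)))) := by
  obtain ⟨hEI, hE⟩ := integral_mixture_exp_le ht hu hs hst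
  have hΓ0 : Γ ≠ 0 := by linarith [ht.ae_le.1]
  set m : ℝ := 9 / 100 * (‖u‖ ^ 2 - ‖t‖ ^ 2) / Γ with hm
  have hsm : Measurable fun x => ENNReal.ofReal (s x) := (measurable_coeFn_Lp s).ennreal_ofReal
  have hgm : Measurable fun x => ENNReal.ofReal (Real.exp (score Γ t u x)) :=
    (measurable_score Γ t u).exp.ennreal_ofReal
  have hsc : ∀ x, Real.exp (score Γ t u x) =
      Real.exp (-m) * Real.exp ((u x - t x) / (5 * Γ)) := by
    intro x
    rw [← Real.exp_add]
    congr 1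
    rw [score, hm]
    field_simp
    ring
  rw [densityLaw, lintegral_withDensity_eq_lintegral_mul _ hsm hgm,
    ← lintegral_const_mul _ (hsm.mul hgm), ← lintegral_const_mul _ hgm,
    ← lintegral_add_right _ (hgm.const_mul _), hlam]
  have hae : ∀ᵐ x ∂μ,
      ENNReal.ofReal (9 / 10) * ((fun x => ENNReal.ofReal (s x)) *
        fun x => ENNReal.ofReal (Real.exp (score Γ t u x))) x +
        ENNReal.ofReal (1 - 9 / 10) * ENNReal.ofReal (Real.exp (score Γ t u x)) =
      ENNReal.ofReal (Real.exp (-m) *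
        ((9 / 10 * s x + 1 / 10) * Real.exp ((u x - t x) / (5 * Γ)))) := by
    filter_upwards [hs.1] with x hx
    rw [Pi.mul_apply, ← ENNReal.ofReal_mul hx, ← ENNReal.ofReal_mul (by norm_num),
      ← ENNReal.ofReal_mul (by norm_num), ← ENNReal.ofReal_add (by positivity)
      (mul_nonneg (by norm_num) (Real.exp_pos _).le), hsc]
    congr 1
    ring
  rw [lintegral_congr_ae hae, ← ofReal_integral_eq_lintegral_ofReal (hEI.const_mul _)
    (by filter_upwards [hs.1] with x hx; simp only [Pi.zero_apply]; positivity),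
    integral_const_mul]
  refine ENNReal.ofReal_le_ofReal ?_
  calc Real.exp (-m) * ∫ x, (9 / 10 * s x + 1 / 10) * Real.exp ((u x - t x) / (5 * Γ)) ∂μ
      ≤ Real.exp (-m) * Real.exp (m - ‖t - u‖ ^ 2 / (65 * Γ)) := by gcongr
    _ = _ := by
      rw [← Real.exp_add]
      congr 1
      ring

/-- The deviation bound for the score statistic on a ball around `t`. -/
lemma randomizedLaw_score_ge_le [IsProbabilityMeasure μ] {Γ : ℝ} {t u s : Lp ℝ 2 μ}
    (ht : IsBoundedDensity Γ t) (hu : IsBoundedDensity Γ u) (hs : IsL2Density s)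
    (hst : dist s t ≤ dist t u / 4) {lam : unitInterval} (hlam : (lam : ℝ) = 9 / 10)
    (n : ℕ) (x : ℝ) :
    randomizedLaw lam n s
        {ω | n * x / (65 * Γ) ≤ ∑ i, score Γ t u (randomizedSample ω i)} ≤
      ENNReal.ofReal (Real.exp (-(n * (‖t - u‖ ^ 2 + x) / (65 * Γ)))) := by
  refine (randomizedLaw_sum_ge_le lam n hs (measurable_score Γ t u) _).trans ?_
  refine (mul_le_mul_right
    (pow_le_pow_left' (lintegral_mixture_exp_score_le ht hu hs hst hlam) n) _).trans_eq ?_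
  rw [← ENNReal.ofReal_pow (Real.exp_pos _).le, ← ENNReal.ofReal_mul (Real.exp_pos _).le,
    ← Real.exp_nat_mul, ← Real.exp_add]
  congr 2
  ring

end Density

/-! ### The test and its two error bounds. -/

theorem mainTheorem4 :
    ∃ lam : unitInterval, 0 < lam ∧ lam < 1 ∧
      ∀ {X : Type*} [MeasurableSpace X] (μ : Measure X) [IsProbabilityMeasure μ] (n : ℕ) (Γ : ℝ)
        (t u : Lp ℝ 2 μ), IsBoundedDensity Γ t → IsBoundedDensity Γ u → t ≠ u → ∀ x : ℝ,
        ∃ ψ : (Fin n → X) → Lp ℝ 2 μ, IsTest t u ψ ∧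
          (∀ s : Lp ℝ 2 μ, IsL2Density s → dist s t ≤ dist t u / 4 →
            randomizedLaw lam n s {ω | ψ (randomizedSample ω) = u} ≤
              ENNReal.ofReal (Real.exp (-(n * (‖t - u‖ ^ 2 + x) / (65 * Γ))))) ∧
          (∀ s : Lp ℝ 2 μ, IsL2Density s → dist s u ≤ dist t u / 4 →
            randomizedLaw lam n s {ω | ψ (randomizedSample ω) = t} ≤
              ENNReal.ofReal (Real.exp (-(n * (‖t - u‖ ^ 2 - x) / (65 * Γ))))) := by
  have hlam : ((⟨9 / 10, by norm_num, by norm_num⟩ : unitInterval) : ℝ) = 9 / 10 := rfl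
  refine ⟨⟨9 / 10, by norm_num, by norm_num⟩, ?_, ?_, ?_⟩
  · rw [← Subtype.coe_lt_coe]
    norm_num
  · rw [← Subtype.coe_lt_coe]
    norm_num
  intro X _ μ _ n Γ t u ht hu htu x
  classical
  let A : Set (Fin n → X) := {y | n * x / (65 * Γ) ≤ ∑ i, score Γ t u (y i)}
  have hA : MeasurableSet A := by
    have := measurable_score Γ t u
    exact measurableSet_le measurable_const (by fun_prop)
  let ψ : (Fin n → X) → Lp ℝ 2 μ := fun y => if y ∈ A then u else t
  have hψu : ∀ y, ψ y = u ↔ y ∈ A := fun y => by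
    by_cases hy : y ∈ A <;> simp [ψ, hy, htu]
  have hψt : ∀ y, ψ y = t ↔ y ∉ A := fun y => by
    by_cases hy : y ∈ A <;> simp [ψ, hy, htu.symm]
  refine ⟨ψ, ⟨fun y => ?_, ?_, ?_⟩, fun s hs hst => ?_, fun s hs hsu => ?_⟩
  · by_cases hy : y ∈ A
    · exact Or.inr ((hψu y).2 hy)
    · exact Or.inl ((hψt y).2 hy)
  · simp_rw [hψt]
    exact hA.compl
  · simp_rw [hψu]
    exact hA
  · simp_rw [hψu]
    exact randomizedLaw_score_ge_le ht hu hs hst hlam n x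
  · simp_rw [hψt]
    -- Exchanging `t` and `u` and replacing `x` by `-x` reverses the inequality. The event here is
    -- the strict one, contained in the closed event that is bounded.
    have h := randomizedLaw_score_ge_le hu ht hs (by rwa [dist_comm u t]) hlam n (-x)
    rw [norm_sub_rev u t, ← sub_eq_add_neg] at h
    refine (measure_mono fun ω hω => ?_).trans h
    simp only [A, Set.mem_ofPred_eq, not_le] at hω ⊢
    simp_rw [score_swap Γ t u, Finset.sum_neg_distrib]
    rw [mul_neg, neg_div]
    exact neg_le_neg hω.le
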